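/- Let $A$ be a finite set and $R\subseteq\widetilde A^*\times\widetilde A^*$, where $\widetilde X=X\cup X^{-1}$. For a presentation ${\rm Inv}\langle X\mid S\rangle$ let $\rho_X$ be the Vagner congruence on $\widetilde X^*$ and $(\rho_X\cup S)^\sharp$ the congruence defining the presented inverse monoid; let $M=\widetilde A^*/\tau$, $\tau=(\rho_A\cup R)^\sharp$. Write $A=\{a_1,\dots,a_n\}$, $A_i=A\setminus\{a_i\}$, let $\theta_i:\widetilde A^*\to\widetilde{A_i}^*$ be the homomorphism erasing $a_i^{\pm1}$, $R\overline\theta_i=\{(r\theta_i,s\theta_i):(r,s)\in R\}$, $\tau_i=(\rho_{A_i}\cup R\overline\theta_i)^\sharp$, $M_i=\widetilde{A_i}^*/\tau_i$, and let $\epsilon^{\mathcal P}:M\to\prod_{i=1}^nM_i$, $w\tau\mapsto((w\theta_1)\tau_1,\dots,(w\theta_n)\tau_n)$, be the eraser morphism. For $u_i\in\widetilde{A_i}^*$ let $\mathcal A(u_i)$ be the Schützenberger automaton of $u_i$ with respect to ${\rm Inv}\langle A_i\mid R\overline\theta_i\rangle$: the subgraph of the Cayley graph of $M_i$ (with edges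 labelled in $\widetilde{A_i}$) induced on the $\mathcal R$-class of $u_i\tau_i$, with initial state $(u_iu_i^{-1})\tau_i$ and terminal state $u_i\tau_i$. Let $\widehat{\mathcal A}(u_i)$ be $\mathcal A(u_i)$ with loops labelled $a_i$ and $a_i^{-1}$ added at every state, and let $\mathcal P(u_1,\dots,u_n)$ be the trim part (the states lying on successful paths) of the product automaton $\widehat{\mathcal A}(u_1)\times\dots\times\widehat{\mathcal A}(u_n)$. For an involutive $\widetilde A$-automaton $\mathcal B$, let $\chi_{a_i}(\mathcal B)$ be obtained by identifying the endpoints of every edge labelled $a_i$, erasing the edges labelled $a_i^{\pm1}$, and folding (identifying states reached from a common state by equally labelled edges until the automaton is deterministic). For a set $S$ of relations on $\widetilde X^*$ and an involutive $\widetilde X$-automaton $\mathcal B$, let ${\rm Cl}_S(\mathcal B)$ be the colimit of the automata obtained from $\mathcal B$ by sequences of foldings and of elementary expansions (if $v$ labels a path $q_1\to q_2$ and $(u,v)\in S$ or $(v,u)\in S$, adjoin a path $q_1\to q_2$ labelled $u$ together with its inverse path; if $u$ is empty, identify $q_1$ and $q_2$). **Proposition.** For all $u_i\in\widetilde{A_i}^*$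 $(1\le i\le n)$, the tuple $(u_1\tau_1,\dots,u_n\tau_n)$ lies in ${\rm Im}\,\epsilon^{\mathcal P}$ if and only if $${\rm Cl}_{R\overline\theta_i}\bigl(\chi_{a_i}(\mathcal P(u_1,\dots,u_n))\bigr)\cong\mathcal A(u_i)\quad\text{for all } i=1,\dots,n,$$ where $\cong$ is isomorphism of automata (preserving edges, labels, initial and terminal states). -/

import Mathlib

universe u

/-! ### Words over `X ∪ X⁻¹` and inverse monoid presentations -/

/-- Words over `X ∪ X⁻¹`. The letter `(x, true)` is `x` and `(x, false)` is the formal inverse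
of `x` (the convention of `FreeGroup`). -/
abbrev InvWord (X : Type u) : Type u := FreeMonoid (X × Bool)

/-- The involution on the alphabet `X ∪ X⁻¹`. -/
def letterInv {X : Type u} (x : X × Bool) : X × Bool := (x.1, !x.2)

/-- The involution `w ↦ w⁻¹` on words: reverse the word and invert each letter. -/
def wordInv {X : Type u} (w : InvWord X) : InvWord X :=
  FreeMonoid.ofList (FreeMonoid.toList w |>.map letterInv).reverse

/-- The generating pairs of the Vagner congruence. -/
inductive VagnerRel {X : Type u} : InvWord X → InvWord X → Prop
  | regular (w : InvWord X) : VagnerRel (w * wordInv w * w) w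
  | commute (v w : InvWord X) :
      VagnerRel (v * wordInv v * (w * wordInv w)) (w * wordInv w * (v * wordInv v))

/-- The Vagner congruence `ρ_X`; its quotient is the free inverse monoid on `X`. -/
def vagnerCon (X : Type u) : Con (InvWord X) := conGen VagnerRel

/-- The congruence `(ρ_X ∪ R)^♯`. -/
def presCon {X : Type u} (R : Set (InvWord X × InvWord X)) : Con (InvWord X) :=
  conGen fun v w => vagnerCon X v w ∨ (v, w) ∈ R

/-- The inverse monoid defined by the presentation `Inv⟨X | R⟩`. -/
abbrev InvPres {X : Type u} (R : Set (InvWord X × InvWord X)) : Type u := (presCon R).Quotient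

/-- Green's relation `𝓡` on a monoid. -/
def GreenR {M : Type u} [Monoid M] (m n : M) : Prop := (∃ x, m = n * x) ∧ ∃ y, n = m * y

theorem wordInv_mul {X : Type u} (v w : InvWord X) :
    wordInv (v * w) = wordInv w * wordInv v := by
  apply FreeMonoid.toList.injective
  simp [wordInv]

theorem presCon_of_vagnerRel {X : Type u} (R : Set (InvWord X × InvWord X)) {v w : InvWord X}
    (h : VagnerRel v w) : presCon R v w :=
  ConGen.Rel.of _ _ (Or.inl (ConGen.Rel.of _ _ h))

theorem greenR_mul_wordInv {X : Type u} (R : Set (InvWord X × InvWord X)) (w : InvWord X) :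
    GreenR ((w * wordInv w : InvWord X) : InvPres R) (w : InvPres R) :=
  ⟨⟨((wordInv w : InvWord X) : InvPres R), rfl⟩, (w : InvPres R),
    ((presCon R).eq.2 (presCon_of_vagnerRel R (.regular w))).symm⟩

/-! ### The eraser morphism -/

/-- The homomorphism `θ_i` deleting all occurrences of `i` and `i⁻¹` from a word. -/
def eraseWord {A : Type u} [DecidableEq A] (i : A) : InvWord A →* InvWord {a : A // a ≠ i} :=
  FreeMonoid.lift fun x => if h : x.1 ≠ i then FreeMonoid.of (⟨x.1, h⟩, x.2) else 1

/-- The relations obtained from `R` by applying `θ_i` to both sides. -/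
def eraseRel {A : Type u} [DecidableEq A] (i : A) (R : Set (InvWord A × InvWord A)) :
    Set (InvWord {a : A // a ≠ i} × InvWord {a : A // a ≠ i}) :=
  (fun r => (eraseWord i r.1, eraseWord i r.2)) '' R

theorem eraseWord_wordInv {A : Type u} [DecidableEq A] (i : A) (w : InvWord A) :
    eraseWord i (wordInv w) = wordInv (eraseWord i w) := by
  induction w using FreeMonoid.recOn with
  | one => rfl
  | of_mul x w ih =>
    rw [wordInv_mul, map_mul, map_mul, wordInv_mul, ih]
    congr 1
    have h : wordInv (FreeMonoid.of x) = FreeMonoid.of (letterInv x) := rfl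
    rw [h, eraseWord, FreeMonoid.lift_eval_of, FreeMonoid.lift_eval_of]
    by_cases hx : x.1 = i
    · simp [letterInv, hx]
      rfl
    · simp [letterInv, hx]
      rfl

theorem presCon_le_ker_eraseWord {A : Type u} [DecidableEq A] (i : A)
    (R : Set (InvWord A × InvWord A)) :
    presCon R ≤ Con.ker ((presCon (eraseRel i R)).mk'.comp (eraseWord i)) := by
  refine Con.conGen_le.2 ?_
  rintro v w (h | h)
  · have key : vagnerCon A ≤ Con.ker ((presCon (eraseRel i R)).mk'.comp (eraseWord i)) := by
      refine Con.conGen_le.2 ?_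
      intro v w h
      refine (presCon (eraseRel i R)).eq.2 (presCon_of_vagnerRel _ ?_)
      cases h with
      | regular w =>
        simp only [map_mul, eraseWord_wordInv]
        exact .regular _
      | commute v w =>
        simp only [map_mul, eraseWord_wordInv]
        exact .commute _ _
    exact key h
  · exact (presCon (eraseRel i R)).eq.2 (ConGen.Rel.of _ _ (Or.inr ⟨(v, w), h, rfl⟩))

/-- The `i`-th component of the eraser morphism, sending the class of `w` to the class
of `w θ_i`. -/
def eraserComponent {A : Type u} [DecidableEq A] (R : Set (InvWord A × InvWord A)) (i : A) :
    InvPres R →* InvPres (eraseRel i R) :=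
  (presCon R).lift ((presCon (eraseRel i R)).mk'.comp (eraseWord i))
    (presCon_le_ker_eraseWord i R)

/-- The eraser morphism. The factors are indexed by the letters themselves. -/
def eraserMorphism {A : Type u} [DecidableEq A] (R : Set (InvWord A × InvWord A)) :
    InvPres R →* ∀ i : A, InvPres (eraseRel i R) :=
  MonoidHom.pi fun i => eraserComponent R i

/-! ### Automata -/

/-- Automata `(Q, I, T, E)` over the alphabet `S`; no finiteness or determinism is assumed. -/
structure Automaton (S : Type u) where
  State : Type u
  init : Set State
  final : Set State
  edge : State → S → State → Prop

namespace Automaton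

variable {S : Type u}

/-- `B.Reads w p q`: there is a path from `p` to `q` in `B` with label `w`. -/
def Reads (B : Automaton S) : List S → B.State → B.State → Prop
  | [], p, q => p = q
  | a :: w, p, q => ∃ r, B.edge p a r ∧ B.Reads w r q

/-- Isomorphism of automata. -/
def Isomorphic (B C : Automaton S) : Prop :=
  ∃ f : B.State ≃ C.State, f '' B.init = C.init ∧ f '' B.final = C.final ∧
    ∀ p a q, B.edge p a q ↔ C.edge (f p) a (f q)

/-- The trim part of an automaton: keep only the states that occur in a successful path. -/
def trim (B : Automaton S) : Automaton S where
  State := {q : B.State // ∃ p ∈ B.init, ∃ t ∈ B.final, ∃ v w, B.Reads v p q ∧ B.Reads w q t}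
  init := {q | q.1 ∈ B.init}
  final := {q | q.1 ∈ B.final}
  edge p a q := B.edge p.1 a q.1

/-- The automaton obtained by identifying states along (the equivalence relation generated by)
the relation `r`. -/
def identify (B : Automaton S) (r : B.State → B.State → Prop) : Automaton S where
  State := Quot r
  init := Quot.mk r '' B.init
  final := Quot.mk r '' B.final
  edge x a y := ∃ p q, B.edge p a q ∧ Quot.mk r p = x ∧ Quot.mk r q = y

/-- The identifications made by iterated folding: the least equivalence relation such that
equally labelled edges leaving equivalent states end in equivalent states. -/
inductive FoldRel (B : Automaton S) : B.State → B.State → Prop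
  | refl (p) : FoldRel B p p
  | symm {p q} : FoldRel B p q → FoldRel B q p
  | trans {p q r} : FoldRel B p q → FoldRel B q r → FoldRel B p r
  | fold {p p' q q'} {a : S} : FoldRel B p p' → B.edge p a q → B.edge p' a q' → FoldRel B q q'

/-- The folding `Fold(B)`, also for infinite `B`. -/
def fold (B : Automaton S) : Automaton S := B.identify B.FoldRel

/-- The product of a family of automata over the same alphabet. -/
def prod {ι : Type u} (B : ι → Automaton S) : Automaton S where
  State := ∀ i, (B i).State
  init := {p | ∀ i, p i ∈ (B i).init}
  final := {p | ∀ i, p i ∈ (B i).final}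
  edge p a q := ∀ i, (B i).edge (p i) a (q i)

/-- Enlarge the alphabet by `i` and `i⁻¹`, adding at every state a loop for each of the two. -/
def addLoops {A : Type u} (i : A) (B : Automaton ({a : A // a ≠ i} × Bool)) :
    Automaton (A × Bool) where
  State := B.State
  init := B.init
  final := B.final
  edge p x q := (x.1 = i ∧ p = q) ∨ ∃ h : x.1 ≠ i, B.edge p (⟨x.1, h⟩, x.2) q

/-- Erase all the edges labelled by `i` and `i⁻¹`. -/
def eraseEdges {A : Type u} (i : A) (B : Automaton (A × Bool)) :
    Automaton ({a : A // a ≠ i} × Bool) where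
  State := B.State
  init := B.init
  final := B.final
  edge p x q := B.edge p (x.1.1, x.2) q

/-- The `i`-contracted automaton: identify the endpoints of each edge labelled `i`, erase the
edges labelled `i` or `i⁻¹` (which have become loops), and fold. -/
def contracted {A : Type u} (i : A) (B : Automaton (A × Bool)) :
    Automaton ({a : A // a ≠ i} × Bool) :=
  ((B.eraseEdges i).identify fun p q => B.edge p (i, true) q).fold

end Automaton

/-- The Schützenberger automaton of the word `w` with respect to `Inv⟨X | R⟩`: the subgraph of
the Cayley graph induced on the `𝓡`-class of `w`, with initial state `w w⁻¹` and terminal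
state `w`. -/
def schutzenberger {X : Type u} (R : Set (InvWord X × InvWord X)) (w : InvWord X) :
    Automaton (X × Bool) where
  State := {m : InvPres R // GreenR m (w : InvPres R)}
  init := {⟨((w * wordInv w : InvWord X) : InvPres R), greenR_mul_wordInv R w⟩}
  final := {⟨(w : InvPres R), ⟨1, (mul_one _).symm⟩, 1, (mul_one _).symm⟩}
  edge p x q := q.1 = p.1 * ((FreeMonoid.of x : InvWord X) : InvPres R)

/-! ### The closure of an automaton with respect to a set of relations -/

namespace Automaton

variable {X : Type u}

/-- An instance of an elementary expansion of `B`: a relation, in either direction, one of whose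
sides labels a path from `src` to `tgt`; the other side, `added`, is to be adjoined. -/
structure ExpansionSite (R : Set (InvWord X × InvWord X)) (B : Automaton (X × Bool)) where
  added : InvWord X
  present : InvWord X
  src : B.State
  tgt : B.State
  rel : (added, present) ∈ R ∨ (present, added) ∈ R
  path : B.Reads (FreeMonoid.toList present) src tgt

variable {R : Set (InvWord X × InvWord X)} {B : Automaton (X × Bool)}

/-- The word to be adjoined, as a list of letters. -/
def ExpansionSite.letters (s : ExpansionSite R B) : List (X × Bool) :=
  FreeMonoid.toList s.added

/-- The edges of the disjoint union of `B` and of the linear automata of all the words to be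
adjoined. -/
inductive UnionEdge (R : Set (InvWord X × InvWord X)) (B : Automaton (X × Bool)) :
    (B.State ⊕ Σ s : ExpansionSite R B, Fin (s.letters.length + 1)) → X × Bool →
    (B.State ⊕ Σ s : ExpansionSite R B, Fin (s.letters.length + 1)) → Prop
  | old {p x q} : B.edge p x q → UnionEdge R B (.inl p) x (.inl q)
  | forward (s : ExpansionSite R B) (k : Fin s.letters.length) :
      UnionEdge R B (.inr ⟨s, k.castSucc⟩) (s.letters.get k) (.inr ⟨s, k.succ⟩)
  | backward (s : ExpansionSite R B) (k : Fin s.letters.length) :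
      UnionEdge R B (.inr ⟨s, k.succ⟩) (letterInv (s.letters.get k)) (.inr ⟨s, k.castSucc⟩)

/-- The endpoints of each new path are glued to the states it has to connect. -/
inductive GlueRel (R : Set (InvWord X × InvWord X)) (B : Automaton (X × Bool)) :
    (B.State ⊕ Σ s : ExpansionSite R B, Fin (s.letters.length + 1)) →
    (B.State ⊕ Σ s : ExpansionSite R B, Fin (s.letters.length + 1)) → Prop
  | src (s : ExpansionSite R B) : GlueRel R B (.inl s.src) (.inr ⟨s, 0⟩)
  | tgt (s : ExpansionSite R B) : GlueRel R B (.inl s.tgt) (.inr ⟨s, Fin.last _⟩)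

/-- All the elementary expansions of `B` performed simultaneously: for every instance a new path,
together with the inverse path, is added from `src` to `tgt`. If the word to be adjoined is
empty, this identifies `src` and `tgt`. -/
def expand (R : Set (InvWord X × InvWord X)) (B : Automaton (X × Bool)) :
    Automaton (X × Bool) :=
  identify
    { State := B.State ⊕ Σ s : ExpansionSite R B, Fin (s.letters.length + 1)
      init := Sum.inl '' B.init
      final := Sum.inl '' B.final
      edge := UnionEdge R B }
    (GlueRel R B)

/-- One round of the iterative procedure: all elementary expansions, then all foldings. -/
def stephenStep (R : Set (InvWord X × InvWord X)) (B : Automaton (X × Bool)) :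
    Automaton (X × Bool) := (expand R B).fold

/-- The canonical morphism from an automaton to the result of one round. -/
def toStephenStep (R : Set (InvWord X × InvWord X)) (B : Automaton (X × Bool)) (q : B.State) :
    (stephenStep R B).State := Quot.mk _ (Quot.mk _ (Sum.inl q))

/-- The sequence obtained from `B` by iterating simultaneous expansions and foldings. -/
def stephenSeq (R : Set (InvWord X × InvWord X)) (B : Automaton (X × Bool)) :
    ℕ → Automaton (X × Bool)
  | 0 => B
  | n + 1 => stephenStep R (stephenSeq R B n)

/-- The relation on the disjoint union of the terms of the sequence that identifies each state
with its image in the next term. -/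
def NextRel (R : Set (InvWord X × InvWord X)) (B : Automaton (X × Bool))
    (x y : Σ n, (stephenSeq R B n).State) : Prop :=
  y = ⟨x.1 + 1, toStephenStep R (stephenSeq R B x.1) x.2⟩

/-- The closure `Cl_R(B)`: the colimit of the automata obtained from `B` by elementary expansions
and foldings. It is computed along the sequence in which all of these operations are performed
simultaneously at each round, which is cofinal in the directed system of all finite sequences
of operations. -/
def closure (R : Set (InvWord X × InvWord X)) (B : Automaton (X × Bool)) :
    Automaton (X × Bool) where
  State := Quot (NextRel R B)
  init := {x | ∃ n, ∃ q ∈ (stephenSeq R B n).init, Quot.mk _ ⟨n, q⟩ = x}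
  final := {x | ∃ n, ∃ q ∈ (stephenSeq R B n).final, Quot.mk _ ⟨n, q⟩ = x}
  edge x a y := ∃ n p q, (stephenSeq R B n).edge p a q ∧
    Quot.mk _ ⟨n, p⟩ = x ∧ Quot.mk _ ⟨n, q⟩ = y

end Automaton

/-- The product automaton of a tuple of words: the (inverse, hence trim) automaton obtained from
the Schützenberger automata of the `w i` with respect to `Inv⟨A \ {i} | R θ_i⟩` by adding loops
labelled `i`, `i⁻¹` at all states of the `i`-th one and taking the trim part of the product. -/
def productAutomaton {A : Type u} [DecidableEq A] (R : Set (InvWord A × InvWord A))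
    (w : ∀ i : A, InvWord {a : A // a ≠ i}) : Automaton (A × Bool) :=
  (Automaton.prod fun i : A => (schutzenberger (eraseRel i R) (w i)).addLoops i).trim

/-!
The automaton `𝒜(w)` accepts exactly the words whose class lies above that of `w` in the natural
partial order, and it is initial among the closed inverse automata accepting `w`. The closure
`Cl_R(B)` is initial among the closed inverse automata to which `B` maps, and `χ_i` is left adjoint
to the addition of loops labelled `i`, so the projection of `𝒫 = 𝒫(w₁, …, wₙ)` onto its `i`-th
factor induces a morphism `Cl(χ_i(𝒫)) → 𝒜(w_i)`. All automata involved being deterministic,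
accessible and with a single initial state, this is an isomorphism as soon as there is a morphism
back, that is, as soon as `Cl(χ_i(𝒫))` accepts `w_i`.

By mapping `Cl(χ_i(𝒫))` to an automaton of upper sets, one sees that it accepts only words lying
above `v θ_i` for some `v` accepted by `𝒫`. Now `𝒫` accepts `v` if and only if `w_j ≤ v θ_j` for
all `j`. The `i`-th isomorphism therefore says that some element `x_i` of the image of the eraser
morphism lies above the given tuple and agrees with it at `i`. Since `a ≤ b` means `a a⁻¹ b = a`,
finitely many such elements combine to `x₁ x₁⁻¹ ⋯ x_{n-1} x_{n-1}⁻¹ xₙ`, which is the given tuple.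
-/

/-! ### Inverse monoids -/

/-- Inverse monoids, presented equationally: `⁻¹` is an involutive anti-automorphism,
`a * a⁻¹ * a = a`, and the idempotents `a * a⁻¹` commute. -/
class InverseMonoid (M : Type*) extends Monoid M, InvolutiveInv M where
  mul_inv_rev (a b : M) : (a * b)⁻¹ = b⁻¹ * a⁻¹
  mul_inv_mul (a : M) : a * a⁻¹ * a = a
  mul_inv_comm (a b : M) : a * a⁻¹ * (b * b⁻¹) = b * b⁻¹ * (a * a⁻¹)

namespace InverseMonoid

section Order

variable {M : Type*} [InverseMonoid M] {a b m n : M}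

theorem inv_one : (1 : M)⁻¹ = 1 := by
  simpa only [one_mul, mul_one] using mul_inv_mul (1 : M)

theorem mul_inv_mul_inv (a : M) : a * a⁻¹ * (a * a⁻¹) = a * a⁻¹ := by
  rw [← mul_assoc, mul_inv_mul]

theorem inv_mul_inv (a : M) : a⁻¹ * a * a⁻¹ = a⁻¹ := by
  simpa only [inv_inv] using mul_inv_mul a⁻¹

theorem mul_inv_mul_eq_of_mul_inv_mul_eq (h : a * a⁻¹ * b = a) : b * b⁻¹ * a = a :=
  calc b * b⁻¹ * a = b * b⁻¹ * (a * a⁻¹) * b := by rw [mul_assoc _ _ b, h]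
    _ = a * a⁻¹ * (b * b⁻¹ * b) := by rw [mul_inv_comm, mul_assoc]
    _ = a := by rw [mul_inv_mul, h]

/-- The natural partial order of an inverse monoid: `a ≤ b` if `a` is a restriction of `b`. -/
instance : PartialOrder M where
  le a b := a * a⁻¹ * b = a
  le_refl := mul_inv_mul
  le_trans a b c hab hbc :=
    calc a * a⁻¹ * c = b * b⁻¹ * a * a⁻¹ * c := by rw [mul_inv_mul_eq_of_mul_inv_mul_eq hab]
      _ = a * a⁻¹ * (b * b⁻¹ * c) := by rw [mul_assoc _ a, mul_inv_comm, mul_assoc]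
      _ = a := by rw [hbc, hab]
  le_antisymm a b hab hba := hab.symm.trans (mul_inv_mul_eq_of_mul_inv_mul_eq hba)

theorem le_def : a ≤ b ↔ a * a⁻¹ * b = a := Iff.rfl

theorem mul_inv_mul_of_le (h : a ≤ b) : b * b⁻¹ * a = a := mul_inv_mul_eq_of_mul_inv_mul_eq h

theorem le_iff_inv_mul_eq : a ≤ b ↔ a⁻¹ * b = a⁻¹ * a := by
  rw [le_def]
  constructor <;> intro h
  · calc a⁻¹ * b = a⁻¹ * (a * a⁻¹ * b) := by
          rw [← mul_assoc, ← mul_assoc, inv_mul_inv]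
      _ = a⁻¹ * a := by rw [h]
  · rw [mul_assoc, h, ← mul_assoc, mul_inv_mul]

theorem inv_le_inv (h : a ≤ b) : a⁻¹ ≤ b⁻¹ := by
  rw [le_iff_inv_mul_eq, inv_inv]
  calc a * b⁻¹ = a * a⁻¹ * (b * b⁻¹) := by rw [← mul_assoc, h]
    _ = a * a⁻¹ := by rw [mul_inv_comm, ← mul_assoc, mul_inv_mul_of_le h]

instance : MulRightMono M where
  elim c a b (h : a ≤ b) := by
    change a * c ≤ b * c
    rw [le_iff_inv_mul_eq] at h ⊢
    simp only [mul_inv_rev, mul_assoc]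
    rw [← mul_assoc a⁻¹, h, mul_assoc]

instance : MulLeftMono M where
  elim c a b h := by
    have := inv_le_inv (mul_le_mul_left (inv_le_inv h) c⁻¹)
    simpa only [mul_inv_rev, inv_inv] using this

theorem mul_inv_le_one (a : M) : a * a⁻¹ ≤ 1 := by
  rw [le_def, mul_one, mul_inv_rev, inv_inv, mul_inv_mul_inv]

theorem mul_mul_inv_le_self (m g : M) : m * g * g⁻¹ ≤ m := by
  simpa only [mul_assoc] using mul_le_of_le_one_right' (a := m) (mul_inv_le_one g)

theorem mul_inv_mul_le_self (m g : M) : m * g⁻¹ * g ≤ m := by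
  simpa only [inv_inv] using mul_mul_inv_le_self m g⁻¹

theorem mul_mul_inv_le (m a : M) : m * a * (m * a)⁻¹ ≤ m * m⁻¹ := by
  rw [mul_inv_rev, ← mul_assoc]
  exact mul_le_mul_left (mul_mul_inv_le_self m a) m⁻¹

theorem mul_mul_inv_cancel (h : m * a * (m * a)⁻¹ = m * m⁻¹) : m * a * a⁻¹ = m := by
  refine (mul_mul_inv_le_self m a).antisymm ?_
  calc m = m * a * (m * a)⁻¹ * m := by rw [h, mul_inv_mul]
    _ = m * a * a⁻¹ * (m⁻¹ * m) := by simp only [mul_inv_rev, mul_assoc]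
    _ ≤ m * a * a⁻¹ := by simpa using mul_le_of_le_one_right' (mul_inv_le_one m⁻¹)

theorem mul_inv_eq_of_greenR (h : GreenR m n) : m * m⁻¹ = n * n⁻¹ := by
  obtain ⟨⟨x, hx⟩, y, hy⟩ := h
  exact le_antisymm (hx ▸ mul_mul_inv_le n x) (hy ▸ mul_mul_inv_le m y)

theorem mem_iff_forall_exists_le {ι : Type*} [Finite ι] {N : ι → Type*}
    [∀ i, InverseMonoid (N i)] {T : Set (∀ i, N i)} (hne : T.Nonempty)
    (hT : ∀ a ∈ T, ∀ b ∈ T, a * a⁻¹ * b ∈ T) {x : ∀ i, N i} :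
    x ∈ T ↔ ∀ i, ∃ a ∈ T, x ≤ a ∧ a i = x i := by
  classical
  refine ⟨fun hx i => ⟨x, hx, le_rfl, rfl⟩, fun h => ?_⟩
  cases nonempty_fintype ι
  suffices key : ∀ s : Finset ι, s.Nonempty → ∃ a ∈ T, x ≤ a ∧ ∀ i ∈ s, a i = x i by
    cases isEmpty_or_nonempty ι
    · obtain ⟨a, ha⟩ := hne
      rwa [Subsingleton.elim x a]
    · obtain ⟨a, ha, -, hax⟩ := key Finset.univ Finset.univ_nonempty
      rwa [← funext fun i => hax i (Finset.mem_univ i)]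
  intro s hs
  induction hs using Finset.Nonempty.cons_induction with
  | singleton i => simpa using h i
  | cons j s _ _ ih =>
    obtain ⟨a, ha, hxa, has⟩ := ih
    obtain ⟨b, hb, hxb, hbj⟩ := h j
    refine ⟨a * a⁻¹ * b, hT a ha b hb, fun i => ?_, fun i hi => ?_⟩
    · calc x i = x i * (x i)⁻¹ * x i := (mul_inv_mul _).symm
        _ ≤ a i * (a i)⁻¹ * b i :=
          mul_le_mul' (mul_le_mul' (hxa i) (inv_le_inv (hxa i))) (hxb i)
    · rcases Finset.mem_cons.1 hi with rfl | hi
      · change a i * (a i)⁻¹ * b i = x i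
        rw [hbj, mul_inv_mul_of_le (hxa i)]
      · change a i * (a i)⁻¹ * b i = x i
        rw [has i hi]
        exact hxb i

end Order

section UpperSet

variable {M : Type*} [InverseMonoid M] {g h : M} {L L' : UpperSet M}

/-- Right translation by `g` carries the upper set `L` into `L'` and right translation by `g⁻¹`
carries `L'` back into `L`: the action of `M` on its upper sets by partial bijections. -/
def Transports (g : M) (L L' : UpperSet M) : Prop :=
  (∀ m ∈ L, m * g ∈ L') ∧ ∀ m ∈ L', m * g⁻¹ ∈ L

theorem transports_one : Transports 1 L L' ↔ L = L' := by
  simp only [Transports, inv_one, mul_one]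
  exact ⟨fun h => SetLike.ext fun m => ⟨h.1 m, h.2 m⟩, fun h => h ▸ ⟨fun _ => id, fun _ => id⟩⟩

theorem Transports.inv (hg : Transports g L L') : Transports g⁻¹ L' L :=
  ⟨hg.2, by simpa only [inv_inv] using hg.1⟩

theorem Transports.mul {L'' : UpperSet M} (hg : Transports g L L'') (hh : Transports h L'' L') :
    Transports (g * h) L L' := by
  refine ⟨fun m hm => ?_, fun m hm => ?_⟩
  · simpa only [mul_assoc] using hh.1 _ (hg.1 m hm)
  · simpa only [mul_inv_rev, mul_assoc] using hg.2 _ (hh.2 m hm)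

theorem Transports.le_of_transports {L₁ L₂ : UpperSet M} (h₁ : Transports g L L₁)
    (h₂ : Transports g L L₂) : L₁ ≤ L₂ := fun m hm =>
  L₁.upper (mul_inv_mul_le_self m g) (h₁.1 _ (h₂.2 m hm))

theorem Transports.unique {L₁ L₂ : UpperSet M} (h₁ : Transports g L L₁)
    (h₂ : Transports g L L₂) : L₁ = L₂ :=
  (h₁.le_of_transports h₂).antisymm (h₂.le_of_transports h₁)

theorem transports_mul :
    Transports (g * h) L L' ↔ ∃ L'', Transports g L L'' ∧ Transports h L'' L' := by
  refine ⟨fun hgh => ?_, fun ⟨L'', hg, hh⟩ => hg.mul hh⟩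
  have back : ∀ m ∈ L', m * h⁻¹ * g⁻¹ ∈ L := fun m hm => by
    simpa only [mul_inv_rev, mul_assoc] using hgh.2 m hm
  refine ⟨upperClosure ((· * g) '' L), ⟨fun m hm => ?_, fun m hm => ?_⟩, fun m hm => ?_,
    fun m hm => ?_⟩
  · exact subset_upperClosure ⟨m, hm, rfl⟩
  · obtain ⟨_, ⟨l, hl, rfl⟩, hlm⟩ := mem_upperClosure.1 hm
    have hl' : l * g * g⁻¹ ∈ L := by
      have := back _ (hgh.1 l hl)
      rw [← mul_assoc] at this
      exact L.upper (mul_le_mul_left (mul_mul_inv_le_self (l * g) h) g⁻¹) this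
    exact L.upper (mul_le_mul_left hlm g⁻¹) hl'
  · obtain ⟨_, ⟨l, hl, rfl⟩, hlm⟩ := mem_upperClosure.1 hm
    have hlgh : l * g * h ∈ L' := by simpa only [mul_assoc] using hgh.1 l hl
    exact L'.upper (mul_le_mul_left hlm h) hlgh
  · exact mem_upperClosure.2 ⟨_, ⟨_, back m hm, rfl⟩, mul_inv_mul_le_self _ g⟩

end UpperSet

end InverseMonoid

/-! ### Presented inverse monoids -/

theorem letterInv_letterInv {X : Type u} (x : X × Bool) : letterInv (letterInv x) = x := by
  simp [letterInv]

theorem wordInv_of {X : Type u} (x : X × Bool) :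
    wordInv (FreeMonoid.of x) = FreeMonoid.of (letterInv x) := rfl

theorem wordInv_wordInv {X : Type u} (w : InvWord X) : wordInv (wordInv w) = w := by
  induction w using FreeMonoid.recOn with
  | one => rfl
  | of_mul x w ih =>
    rw [wordInv_mul, wordInv_mul, ih, wordInv_of, wordInv_of, letterInv_letterInv]

theorem eq_of_commute_of_mul_mul_eq {S : Type*} [Semigroup S] {a b c : S} (hab : a * b * a = a)
    (hba : b * a * b = b) (hac : a * c * a = a) (hca : c * a * c = c)
    (hl : Commute (a * b) (a * c)) (hr : Commute (b * a) (c * a)) : b = c :=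
  calc b = b * (a * c * a) * b := by rw [hac, hba]
    _ = b * (a * c * (a * b)) := by simp only [mul_assoc]
    _ = b * (a * b * a) * c := by rw [← hl.eq]; simp only [mul_assoc]
    _ = b * a * (c * a) * c := by rw [hab, mul_assoc (b * a), hca]
    _ = c * (a * b * a) * c := by rw [hr.eq]; simp only [mul_assoc]
    _ = c := by rw [hab, hca]

namespace InvPres

variable {X : Type u} {R : Set (InvWord X × InvWord X)}

theorem exists_word_eq (m : InvPres R) : ∃ w : InvWord X, (w : InvPres R) = m :=
  Con.mk'_surjective m

theorem coe_eq_of_mem {r : InvWord X × InvWord X} (hr : r ∈ R) :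
    (r.1 : InvPres R) = (r.2 : InvPres R) :=
  (presCon R).eq.2 (ConGen.Rel.of _ _ (Or.inr hr))

theorem mul_wordInv_mul (w : InvWord X) :
    (w * wordInv w * w : InvPres R) = (w : InvPres R) :=
  (presCon R).eq.2 (presCon_of_vagnerRel R (.regular w))

theorem wordInv_mul_wordInv (w : InvWord X) :
    (wordInv w * w * wordInv w : InvPres R) = (wordInv w : InvWord X) := by
  simpa only [wordInv_wordInv] using mul_wordInv_mul (R := R) (wordInv w)

theorem mul_wordInv_comm (v w : InvWord X) :
    Commute (v * wordInv v : InvPres R) (w * wordInv w : InvPres R) :=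
  (presCon R).eq.2 (presCon_of_vagnerRel R (.commute v w))

theorem wordInv_mul_comm (v w : InvWord X) :
    Commute (wordInv v * v : InvPres R) (wordInv w * w : InvPres R) := by
  simpa only [wordInv_wordInv] using mul_wordInv_comm (R := R) (wordInv v) (wordInv w)

theorem coe_wordInv_eq {v w : InvWord X} (h : (v : InvPres R) = w) :
    ((wordInv v : InvWord X) : InvPres R) = (wordInv w : InvWord X) := by
  refine eq_of_commute_of_mul_mul_eq (a := (v : InvPres R)) (mul_wordInv_mul v)
    (wordInv_mul_wordInv v) ?_ ?_ ?_ ?_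
  · rw [h, mul_wordInv_mul]
  · rw [h, wordInv_mul_wordInv]
  · simpa only [← h] using mul_wordInv_comm (R := R) v w
  · simpa only [← h] using wordInv_mul_comm (R := R) v w

instance : InverseMonoid (InvPres R) where
  inv q := Con.liftOn q (fun w => ((wordInv w : InvWord X) : InvPres R))
    fun _ _ h => coe_wordInv_eq ((presCon R).eq.2 h)
  inv_inv := by
    rintro ⟨w⟩
    exact congrArg _ (wordInv_wordInv w)
  mul_inv_rev := by
    rintro ⟨v⟩ ⟨w⟩
    exact congrArg _ (wordInv_mul v w)
  mul_inv_mul := by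
    rintro ⟨w⟩
    exact mul_wordInv_mul w
  mul_inv_comm := by
    rintro ⟨v⟩ ⟨w⟩
    exact mul_wordInv_comm v w

theorem coe_inv (w : InvWord X) : (w : InvPres R)⁻¹ = ((wordInv w : InvWord X) : InvPres R) := rfl

end InvPres

/-! ### Paths and morphisms of automata -/

namespace Automaton

section Paths

variable {S : Type u} {B : Automaton S}

theorem reads_nil {p q : B.State} : B.Reads [] p q ↔ p = q := Iff.rfl

theorem reads_cons {a : S} {w : List S} {p q : B.State} :
    B.Reads (a :: w) p q ↔ ∃ r, B.edge p a r ∧ B.Reads w r q := Iff.rfl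

theorem reads_append {v w : List S} {p q : B.State} :
    B.Reads (v ++ w) p q ↔ ∃ r, B.Reads v p r ∧ B.Reads w r q := by
  induction v generalizing p with
  | nil => simp only [List.nil_append, reads_nil, exists_eq_left']
  | cons a v ih =>
    simp only [List.cons_append, reads_cons, ih]
    grind

theorem reads_singleton {a : S} {p q : B.State} : B.Reads [a] p q ↔ B.edge p a q := by
  simp only [reads_cons, reads_nil, exists_eq_right]

theorem Reads.exists_path {w : List S} {p q : B.State} (h : B.Reads w p q) :
    ∃ g : Fin (w.length + 1) → B.State, g 0 = p ∧ g (Fin.last _) = q ∧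
      ∀ k : Fin w.length, B.edge (g k.castSucc) (w.get k) (g k.succ) := by
  induction w generalizing p with
  | nil => exact ⟨fun _ => p, rfl, h, fun k => k.elim0⟩
  | cons a w ih =>
    obtain ⟨r, h₁, h₂⟩ := h
    obtain ⟨g, rfl, rfl, hg⟩ := ih h₂
    exact ⟨Fin.cons p g, rfl, rfl, Fin.cases h₁ hg⟩

theorem reads_take_of_path {w : List S} {g : Fin (w.length + 1) → B.State}
    (hg : ∀ k : Fin w.length, B.edge (g k.castSucc) (w.get k) (g k.succ))
    (k : Fin (w.length + 1)) : B.Reads (w.take k) (g 0) (g k) := by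
  induction k using Fin.induction with
  | zero => exact reads_nil.2 rfl
  | succ k ih =>
    have : w.take (k.succ : ℕ) = w.take (k.castSucc : ℕ) ++ [w.get k] := by
      simp
    rw [this, reads_append]
    exact ⟨_, ih, reads_singleton.2 (hg k)⟩

theorem reads_of_path {w : List S} {g : Fin (w.length + 1) → B.State}
    (hg : ∀ k : Fin w.length, B.edge (g k.castSucc) (w.get k) (g k.succ)) :
    B.Reads w (g 0) (g (Fin.last _)) := by
  simpa using reads_take_of_path hg (Fin.last _)

/-- The word `w` labels a successful path of `B`. -/
def Accepts (B : Automaton S) (w : List S) : Prop :=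
  ∃ p ∈ B.init, ∃ q ∈ B.final, B.Reads w p q

/-- At most one edge with a given label leaves a given state. -/
def Deterministic (B : Automaton S) : Prop :=
  ∀ ⦃p a q q'⦄, B.edge p a q → B.edge p a q' → q = q'

theorem Deterministic.reads (hB : B.Deterministic) {w : List S} {p q q' : B.State}
    (h : B.Reads w p q) (h' : B.Reads w p q') : q = q' := by
  induction w generalizing p with
  | nil => exact h.symm.trans h'
  | cons a w ih =>
    obtain ⟨r, h₁, h₂⟩ := h
    obtain ⟨r', h₁', h₂'⟩ := h'
    obtain rfl := hB h₁ h₁'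
    exact ih h₂ h₂'

/-- Every state can be reached from an initial state. -/
def Accessible (B : Automaton S) : Prop := ∀ q, ∃ p ∈ B.init, ∃ w, B.Reads w p q

end Paths

section Hom

variable {S : Type u} {B C D : Automaton S}

/-- Morphisms of automata: maps on states preserving labelled edges, initial states and final
states. -/
structure Hom (B C : Automaton S) where
  toFun : B.State → C.State
  map_edge : ∀ {p a q}, B.edge p a q → C.edge (toFun p) a (toFun q)
  map_init : ∀ {p}, p ∈ B.init → toFun p ∈ C.init
  map_final : ∀ {p}, p ∈ B.final → toFun p ∈ C.final

namespace Hom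

instance : CoeFun (Hom B C) fun _ => B.State → C.State := ⟨toFun⟩

/-- Composition of morphisms, in the order of functions. -/
def comp (g : Hom C D) (f : Hom B C) : Hom B D where
  toFun := g ∘ f
  map_edge h := g.map_edge (f.map_edge h)
  map_init h := g.map_init (f.map_init h)
  map_final h := g.map_final (f.map_final h)

theorem reads (f : Hom B C) {w : List S} {p q : B.State} (h : B.Reads w p q) :
    C.Reads w (f p) (f q) := by
  induction w generalizing p with
  | nil => exact congrArg f h
  | cons a w ih =>
    obtain ⟨r, h₁, h₂⟩ := h
    exact ⟨f r, f.map_edge h₁, ih h₂⟩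

theorem accepts (f : Hom B C) {w : List S} : B.Accepts w → C.Accepts w :=
  fun ⟨_, hp, _, hq, h⟩ => ⟨_, f.map_init hp, _, f.map_final hq, f.reads h⟩

theorem apply_eq_self (hd : B.Deterministic) (ha : B.Accessible) (hi : B.init.Subsingleton)
    (f : Hom B B) (q : B.State) : f q = q := by
  obtain ⟨p, hp, w, hw⟩ := ha q
  refine hd.reads (f.reads hw) ?_
  rwa [hi (f.map_init hp) hp]

end Hom

theorem isomorphic_of_hom_hom (hBd : B.Deterministic) (hBa : B.Accessible)
    (hBi : B.init.Subsingleton) (hCd : C.Deterministic) (hCa : C.Accessible)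
    (hCi : C.init.Subsingleton) (f : Hom B C) (g : Hom C B) : B.Isomorphic C := by
  have hgf : ∀ p, g (f p) = p := (g.comp f).apply_eq_self hBd hBa hBi
  have hfg : ∀ q, f (g q) = q := (f.comp g).apply_eq_self hCd hCa hCi
  refine ⟨⟨f, g, hgf, hfg⟩, ?_, ?_, fun p a q => ⟨f.map_edge, fun h => ?_⟩⟩
  · exact Set.Subset.antisymm (Set.image_subset_iff.2 fun _ => f.map_init)
      fun q hq => ⟨g q, g.map_init hq, hfg q⟩
  · exact Set.Subset.antisymm (Set.image_subset_iff.2 fun _ => f.map_final)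
      fun q hq => ⟨g q, g.map_final hq, hfg q⟩
  · simpa only [Equiv.coe_fn_mk, hgf] using g.map_edge h

theorem Isomorphic.nonempty_hom_symm (h : B.Isomorphic C) : Nonempty (Hom C B) := by
  obtain ⟨f, hi, hf, he⟩ := h
  refine ⟨f.symm, fun {p a q} h => ?_, fun hp => ?_, fun hp => ?_⟩
  · simpa only [he, f.apply_symm_apply] using h
  · obtain ⟨q, hq, rfl⟩ := hi ▸ hp
    rwa [f.symm_apply_apply]
  · obtain ⟨q, hq, rfl⟩ := hf ▸ hp
    rwa [f.symm_apply_apply]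

end Hom

section Identify

variable {S : Type u} {B C : Automaton S} {r : B.State → B.State → Prop}

/-- The projection of an automaton onto the result of an identification of states. -/
def toIdentify (B : Automaton S) (r : B.State → B.State → Prop) : Hom B (B.identify r) where
  toFun := Quot.mk r
  map_edge h := ⟨_, _, h, rfl, rfl⟩
  map_init hp := ⟨_, hp, rfl⟩
  map_final hp := ⟨_, hp, rfl⟩

/-- The morphism out of an automaton with identified states, induced by a morphism that is
constant on the states to be identified. -/
def Hom.identifyLift (f : Hom B C) (h : ∀ p q, r p q → f p = f q) : Hom (B.identify r) C where
  toFun := Quot.lift f h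
  map_edge := by
    rintro _ a _ ⟨p, q, hpq, rfl, rfl⟩
    exact f.map_edge hpq
  map_init := by
    rintro _ ⟨p, hp, rfl⟩
    exact f.map_init hp
  map_final := by
    rintro _ ⟨p, hp, rfl⟩
    exact f.map_final hp

theorem Accessible.identify (hB : B.Accessible) (r : B.State → B.State → Prop) :
    (B.identify r).Accessible := by
  rintro ⟨q⟩
  obtain ⟨p, hp, w, hw⟩ := hB q
  exact ⟨_, ⟨p, hp, rfl⟩, w, (toIdentify B r).reads hw⟩

theorem FoldRel.apply_eq (hC : C.Deterministic) (f : Hom B C) {p q : B.State}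
    (h : B.FoldRel p q) : f p = f q := by
  induction h with
  | refl => rfl
  | symm _ ih => exact ih.symm
  | trans _ _ ih₁ ih₂ => exact ih₁.trans ih₂
  | fold _ h₁ h₂ ih => exact hC (f.map_edge h₁) (ih ▸ f.map_edge h₂)

theorem foldRel_of_mk_eq {p q : B.State} (h : Quot.mk B.FoldRel p = Quot.mk B.FoldRel q) :
    B.FoldRel p q :=
  (Equivalence.quot_mk_eq_iff ⟨.refl, .symm, .trans⟩ p q).1 h

theorem deterministic_fold (B : Automaton S) : B.fold.Deterministic := by
  rintro _ a _ _ ⟨p, q, h, rfl, rfl⟩ ⟨p', q', h', hp, rfl⟩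
  exact Quot.sound (.fold (foldRel_of_mk_eq hp.symm) h h')

end Identify

/-! ### Closed inverse automata -/

section Involutive

variable {X : Type u} {B : Automaton (X × Bool)} {v w : InvWord X} {p q : B.State}

theorem reads_mul :
    B.Reads (v * w).toList p q ↔ ∃ r, B.Reads v.toList p r ∧ B.Reads w.toList r q := by
  rw [FreeMonoid.toList_mul, reads_append]

theorem reads_of {x : X × Bool} : B.Reads (FreeMonoid.of x).toList p q ↔ B.edge p x q :=
  reads_singleton

theorem reads_one : B.Reads (1 : InvWord X).toList p q ↔ p = q := Iff.rfl

/-- Edges come in mutually inverse pairs. -/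
def Involutive (B : Automaton (X × Bool)) : Prop :=
  ∀ ⦃p a q⦄, B.edge p a q → B.edge q (letterInv a) p

theorem Involutive.reads (hB : B.Involutive) (h : B.Reads w.toList p q) :
    B.Reads (wordInv w).toList q p := by
  induction w using FreeMonoid.recOn generalizing p with
  | one => exact h.symm
  | of_mul x w ih =>
    obtain ⟨r, h₁, h₂⟩ := reads_mul.1 h
    rw [wordInv_mul, wordInv_of]
    exact reads_mul.2 ⟨r, ih h₂, reads_of.2 (hB (reads_of.1 h₁))⟩

theorem Involutive.identify (hB : B.Involutive) (r : B.State → B.State → Prop) :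
    (B.identify r).Involutive := by
  rintro _ a _ ⟨p, q, h, rfl, rfl⟩
  exact ⟨q, p, hB h, rfl, rfl⟩

theorem reads_mul_wordInv (hd : B.Deterministic) (hi : B.Involutive) :
    B.Reads (w * wordInv w).toList p q ↔ p = q ∧ ∃ r, B.Reads w.toList p r := by
  rw [reads_mul]
  constructor
  · rintro ⟨r, h₁, h₂⟩
    exact ⟨hd.reads (hi.reads h₁) h₂, r, h₁⟩
  · rintro ⟨rfl, r, h⟩
    exact ⟨r, h, hi.reads h⟩

/-- The congruence of words labelling the same paths. -/
def pathCon (B : Automaton (X × Bool)) : Con (InvWord X) where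
  r v w := ∀ p q, B.Reads v.toList p q ↔ B.Reads w.toList p q
  iseqv := ⟨fun _ _ _ => Iff.rfl, fun h p q => (h p q).symm,
    fun h h' p q => (h p q).trans (h' p q)⟩
  mul' h h' p q := by simp only [reads_mul, h _ _, h' _ _]

theorem vagnerCon_le_pathCon (hd : B.Deterministic) (hi : B.Involutive) :
    vagnerCon X ≤ B.pathCon := by
  refine Con.conGen_le.2 ?_
  intro v w h p q
  cases h with
  | regular =>
    simp only [reads_mul (v := w * wordInv w), reads_mul_wordInv hd hi]
    grind
  | commute v w =>
    simp only [reads_mul (v := w * wordInv w), reads_mul (v := v * wordInv v),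
      reads_mul_wordInv hd hi]
    grind

end Involutive

section IsClosedInverse

variable {X : Type u} {R : Set (InvWord X × InvWord X)} {B : Automaton (X × Bool)}

/-- `B` is a deterministic involutive automaton in which the two sides of every relation of `R`
label the same paths: such automata are the fixed points of foldings and expansions. -/
structure IsClosedInverse (R : Set (InvWord X × InvWord X)) (B : Automaton (X × Bool)) :
    Prop where
  deterministic : B.Deterministic
  involutive : B.Involutive
  reads_iff : ∀ r ∈ R, ∀ p q, B.Reads r.1.toList p q ↔ B.Reads r.2.toList p q

theorem IsClosedInverse.presCon_le_pathCon (hB : B.IsClosedInverse R) :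
    presCon R ≤ B.pathCon := by
  refine Con.conGen_le.2 ?_
  rintro v w (h | h)
  · exact vagnerCon_le_pathCon hB.deterministic hB.involutive h
  · exact hB.reads_iff _ h

theorem IsClosedInverse.reads_congr (hB : B.IsClosedInverse R) {v w : InvWord X}
    (h : (v : InvPres R) = w) {p q : B.State} :
    B.Reads v.toList p q ↔ B.Reads w.toList p q :=
  hB.presCon_le_pathCon ((presCon R).eq.1 h) p q

end IsClosedInverse

/-! ### The closure as a free construction -/

section Orbits

variable {S : Type u} {B : Automaton S}

/-- The colimit of `B → B → B → ⋯` along an endomorphism `σ`: every state is identified with its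
image. For the disjoint union of a sequence of automata and the morphism sending each of them to
the next one, this is the colimit of the sequence. -/
abbrev orbits (B : Automaton S) (σ : B.State → B.State) : Automaton S :=
  B.identify fun x y => y = σ x

/-- The projection onto the colimit along an endomorphism. -/
abbrev toOrbits (B : Automaton S) (σ : B.State → B.State) : Hom B (B.orbits σ) := toIdentify B _

theorem toOrbits_apply (σ : B.State → B.State) (p : B.State) :
    toOrbits B σ (σ p) = toOrbits B σ p :=
  (Quot.sound (r := fun x y => y = σ x) rfl).symm

theorem toOrbits_iterate (σ : B.State → B.State) (k : ℕ) (p : B.State) :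
    toOrbits B σ (σ^[k] p) = toOrbits B σ p := by
  induction k with
  | zero => rfl
  | succ k ih => rw [Function.iterate_succ_apply', toOrbits_apply, ih]

theorem exists_iterate_eq_of_toOrbits_eq {σ : B.State → B.State} {p q : B.State}
    (h : toOrbits B σ p = toOrbits B σ q) : ∃ k l, σ^[k] p = σ^[l] q := by
  replace h : Relation.EqvGen (fun x y => y = σ x) p q := Quot.eqvGen_exact h
  induction h with
  | rel x y h => exact ⟨1, 0, h.symm⟩
  | refl x => exact ⟨0, 0, rfl⟩
  | symm x y _ ih =>
    obtain ⟨k, l, h⟩ := ih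
    exact ⟨l, k, h.symm⟩
  | trans x y z _ _ ih₁ ih₂ =>
    obtain ⟨k, l, h⟩ := ih₁
    obtain ⟨m, o, h'⟩ := ih₂
    refine ⟨m + k, l + o, ?_⟩
    rw [Function.iterate_add_apply, h, ← Function.iterate_add_apply, add_comm,
      Function.iterate_add_apply, h', ← Function.iterate_add_apply]

theorem Hom.reads_iterate (σ : Hom B B) {w : List S} {p q : B.State} (h : B.Reads w p q) (k : ℕ) :
    B.Reads w (σ^[k] p) (σ^[k] q) := by
  induction k generalizing p q with
  | zero => exact h
  | succ _ ih => exact ih (σ.reads h)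

theorem Hom.exists_reads_of_reads_orbits (σ : Hom B B) {w : List S} {x y : (B.orbits σ).State}
    (h : (B.orbits σ).Reads w x y) :
    ∃ p q, toOrbits B σ p = x ∧ toOrbits B σ q = y ∧ B.Reads w p q := by
  induction w generalizing x with
  | nil =>
    obtain ⟨p, rfl⟩ := Quot.exists_rep x
    exact ⟨p, p, rfl, h, rfl⟩
  | cons a w ih =>
    obtain ⟨_, ⟨p, r, hpr, rfl, rfl⟩, h⟩ := h
    obtain ⟨r', q, hr, rfl, hq⟩ := ih h
    obtain ⟨k, l, hkl⟩ := exists_iterate_eq_of_toOrbits_eq hr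
    have hp := σ.reads_iterate (reads_singleton.2 hpr) l
    rw [← hkl] at hp
    exact ⟨σ^[l] p, σ^[k] q, toOrbits_iterate _ _ _, toOrbits_iterate _ _ _,
      reads_append.2 ⟨_, hp, σ.reads_iterate hq k⟩⟩

theorem Hom.deterministic_orbits (σ : Hom B B)
    (hσ : ∀ {p a q q'}, B.edge p a q → B.edge p a q' → σ q = σ q') :
    (B.orbits σ).Deterministic := by
  rintro _ a _ _ ⟨p, q, h, rfl, rfl⟩ ⟨p', q', h', hp, rfl⟩
  obtain ⟨k, l, hkl⟩ := exists_iterate_eq_of_toOrbits_eq hp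
  have h₁ := σ.reads_iterate (reads_singleton.2 h) l
  have h₂ := σ.reads_iterate (reads_singleton.2 h') k
  rw [hkl] at h₂
  change toOrbits B σ q = toOrbits B σ q'
  rw [← toOrbits_iterate σ (l + 1) q, ← toOrbits_iterate σ (k + 1) q',
    Function.iterate_succ_apply', Function.iterate_succ_apply',
    hσ (reads_singleton.1 h₁) (reads_singleton.1 h₂)]

end Orbits

section Expansion

variable {X : Type u} {R : Set (InvWord X × InvWord X)} {B C : Automaton (X × Bool)}

/-- The disjoint union of `B` and of the linear automata of all the words to be adjoined, whose
quotient by `GlueRel` is `expand R B`. -/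
def expansionUnion (R : Set (InvWord X × InvWord X)) (B : Automaton (X × Bool)) :
    Automaton (X × Bool) where
  State := B.State ⊕ Σ s : ExpansionSite R B, Fin (s.letters.length + 1)
  init := Sum.inl '' B.init
  final := Sum.inl '' B.final
  edge := UnionEdge R B

/-- The canonical morphism from an automaton to its expansion. -/
def toExpand (R : Set (InvWord X × InvWord X)) (B : Automaton (X × Bool)) : Hom B (expand R B) :=
  Hom.comp (toIdentify (expansionUnion R B) (GlueRel R B))
    { toFun := Sum.inl
      map_edge := UnionEdge.old
      map_init := Set.mem_image_of_mem _
      map_final := Set.mem_image_of_mem _ }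

/-- The map `toStephenStep` as a morphism. -/
def toStephenStepHom (R : Set (InvWord X × InvWord X)) (B : Automaton (X × Bool)) :
    Hom B (stephenStep R B) :=
  Hom.comp (toIdentify _ _) (toExpand R B)

theorem involutive_stephenStep (hB : B.Involutive) : (stephenStep R B).Involutive := by
  have hU : (expansionUnion R B).Involutive := by
    rintro _ _ _ (h | ⟨s, k⟩ | ⟨s, k⟩)
    · exact .old (hB h)
    · exact .backward s k
    · rw [letterInv_letterInv]
      exact .forward s k
  exact (hU.identify (GlueRel R B)).identify _

/-- The states of the path adjoined at an expansion site. -/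
def sitePath (s : ExpansionSite R B) (k : Fin (s.letters.length + 1)) : (expand R B).State :=
  Quot.mk _ (Sum.inr ⟨s, k⟩)

theorem sitePath_zero (s : ExpansionSite R B) : sitePath s 0 = toExpand R B s.src :=
  (Quot.sound (.src s)).symm

theorem sitePath_last (s : ExpansionSite R B) : sitePath s (Fin.last _) = toExpand R B s.tgt :=
  (Quot.sound (.tgt s)).symm

theorem edge_sitePath (s : ExpansionSite R B) (k : Fin s.letters.length) :
    (expand R B).edge (sitePath s k.castSucc) (s.letters.get k) (sitePath s k.succ) :=
  ⟨_, _, .forward s k, rfl, rfl⟩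

theorem reads_added_toStephenStep (s : ExpansionSite R B) :
    (stephenStep R B).Reads s.added.toList (toStephenStep R B s.src)
      (toStephenStep R B s.tgt) := by
  refine (toIdentify (expand R B) _).reads (p := toExpand R B s.src) (q := toExpand R B s.tgt) ?_
  rw [← sitePath_zero, ← sitePath_last]
  exact reads_of_path (edge_sitePath s)

theorem accessible_stephenStep (hB : B.Accessible) : (stephenStep R B).Accessible := by
  have hold (q : B.State) : ∃ p ∈ (expand R B).init, ∃ w,
      (expand R B).Reads w p (toExpand R B q) := by
    obtain ⟨p, hp, w, hw⟩ := hB q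
    exact ⟨_, (toExpand R B).map_init hp, w, (toExpand R B).reads hw⟩
  refine Accessible.identify ?_ _
  rintro ⟨q | ⟨s, k⟩⟩
  · exact hold q
  · obtain ⟨p, hp, w, hw⟩ := hold s.src
    rw [← sitePath_zero] at hw
    exact ⟨p, hp, _, reads_append.2 ⟨_, hw, reads_take_of_path (edge_sitePath s) k⟩⟩

theorem exists_hom_stephenStep (hC : C.IsClosedInverse R) (f : Hom B C) :
    ∃ g : Hom (stephenStep R B) C, ∀ q, g (toStephenStep R B q) = f q := by
  have hpath (s : ExpansionSite R B) : ∃ g : Fin (s.letters.length + 1) → C.State,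
      g 0 = f s.src ∧ g (Fin.last _) = f s.tgt ∧
        ∀ k : Fin s.letters.length, C.edge (g k.castSucc) (s.letters.get k) (g k.succ) := by
    refine Reads.exists_path ?_
    have h := f.reads s.path
    rcases s.rel with hr | hr
    · exact (hC.reads_iff _ hr _ _).2 h
    · exact (hC.reads_iff _ hr _ _).1 h
  choose g g_zero g_last g_edge using hpath
  let onUnion : Hom (expansionUnion R B) C :=
    { toFun := Sum.elim f fun x => g x.1 x.2
      map_edge := by
        rintro _ _ _ (h | ⟨s, k⟩ | ⟨s, k⟩)
        · exact f.map_edge h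
        · exact g_edge s k
        · exact hC.involutive (g_edge s k)
      map_init := by
        rintro _ ⟨q, hq, rfl⟩
        exact f.map_init hq
      map_final := by
        rintro _ ⟨q, hq, rfl⟩
        exact f.map_final hq }
  let onExpand : Hom ((expansionUnion R B).identify (GlueRel R B)) C := onUnion.identifyLift <| by
    rintro _ _ (s | s)
    · exact (g_zero s).symm
    · exact (g_last s).symm
  exact ⟨Hom.identifyLift (B := expand R B) onExpand fun p q h =>
    h.apply_eq hC.deterministic onExpand, fun q => rfl⟩

end Expansion

section Closure

variable {X : Type u} {R : Set (InvWord X × InvWord X)} {B C : Automaton (X × Bool)}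

/-- The disjoint union of the terms of the sequence `stephenSeq R B`. -/
def stages (R : Set (InvWord X × InvWord X)) (B : Automaton (X × Bool)) :
    Automaton (X × Bool) where
  State := Σ n, (stephenSeq R B n).State
  init := {x | x.2 ∈ (stephenSeq R B x.1).init}
  final := {x | x.2 ∈ (stephenSeq R B x.1).final}
  edge x a y := ∃ n p q, (stephenSeq R B n).edge p a q ∧ ⟨n, p⟩ = x ∧ ⟨n, q⟩ = y

/-- The inclusion of a term of the sequence into the disjoint union. -/
def toStages (R : Set (InvWord X × InvWord X)) (B : Automaton (X × Bool)) (n : ℕ) :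
    Hom (stephenSeq R B n) (stages R B) where
  toFun p := ⟨n, p⟩
  map_edge h := ⟨n, _, _, h, rfl, rfl⟩
  map_init hp := hp
  map_final hp := hp

/-- The endomorphism of the disjoint union mapping each term of the sequence to the next one. -/
def nextStage (R : Set (InvWord X × InvWord X)) (B : Automaton (X × Bool)) :
    Hom (stages R B) (stages R B) where
  toFun x := ⟨x.1 + 1, toStephenStep R (stephenSeq R B x.1) x.2⟩
  map_edge := by
    rintro _ a _ ⟨n, p, q, h, rfl, rfl⟩
    exact ⟨n + 1, _, _, (toStephenStepHom R _).map_edge h, rfl, rfl⟩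
  map_init {x} hx := (toStephenStepHom R (stephenSeq R B x.1)).map_init hx
  map_final {x} hx := (toStephenStepHom R (stephenSeq R B x.1)).map_final hx

theorem closure_eq_orbits : closure R B = (stages R B).orbits (nextStage R B) := by
  have hset (s : ∀ n, Set (stephenSeq R B n).State) :
      {x : Quot (NextRel R B) | ∃ n, ∃ q ∈ s n, Quot.mk _ ⟨n, q⟩ = x} =
        Quot.mk _ '' {x : Σ n, (stephenSeq R B n).State | x.2 ∈ s x.1} := by
    ext x
    exact ⟨fun ⟨n, q, hq, hx⟩ => ⟨⟨n, q⟩, hq, hx⟩, fun ⟨⟨n, q⟩, hq, hx⟩ => ⟨n, q, hq, hx⟩⟩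
  have hedge (x y : (closure R B).State) (a : X × Bool) :
      (closure R B).edge x a y =
        ((stages R B).identify (NextRel R B)).edge x a y := by
    refine propext ⟨?_, ?_⟩
    · rintro ⟨n, p, q, h, hx, hy⟩
      exact ⟨_, _, ⟨n, p, q, h, rfl, rfl⟩, hx, hy⟩
    · rintro ⟨_, _, ⟨n, p, q, h, rfl, rfl⟩, hx, hy⟩
      exact ⟨n, p, q, h, hx, hy⟩
  exact congr (congr (congrArg (Automaton.mk (Quot (NextRel R B))) (hset _)) (hset _))
    (funext fun x => funext fun a => funext fun y => hedge x y a)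

theorem exists_reads_of_reads_stages {n : ℕ} {p : (stephenSeq R B n).State}
    {w : List (X × Bool)} {y : (stages R B).State}
    (h : (stages R B).Reads w (toStages R B n p) y) :
    ∃ q, y = toStages R B n q ∧ (stephenSeq R B n).Reads w p q := by
  induction w generalizing p with
  | nil => exact ⟨p, h.symm, rfl⟩
  | cons a w ih =>
    obtain ⟨_, ⟨_, _, r, hpr, ⟨⟩, rfl⟩, h⟩ := h
    obtain ⟨q, rfl, hq⟩ := ih h
    exact ⟨q, rfl, r, hpr, hq⟩

theorem involutive_closure (hB : B.Involutive) : (closure R B).Involutive := by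
  have hseq (n : ℕ) : (stephenSeq R B n).Involutive := by
    induction n with
    | zero => exact hB
    | succ n ih => exact involutive_stephenStep ih
  rw [closure_eq_orbits]
  refine Involutive.identify ?_ _
  rintro _ a _ ⟨n, p, q, h, rfl, rfl⟩
  exact ⟨n, q, p, hseq n h, rfl, rfl⟩

theorem accessible_closure (hB : B.Accessible) : (closure R B).Accessible := by
  have hseq (n : ℕ) : (stephenSeq R B n).Accessible := by
    induction n with
    | zero => exact hB
    | succ n ih => exact accessible_stephenStep ih
  rw [closure_eq_orbits]
  refine Accessible.identify ?_ _
  rintro ⟨n, q⟩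
  obtain ⟨p, hp, w, hw⟩ := hseq n q
  exact ⟨⟨n, p⟩, hp, w, (toStages R B n).reads hw⟩

theorem deterministic_closure : (closure R B).Deterministic := by
  rw [closure_eq_orbits]
  refine (nextStage R B).deterministic_orbits ?_
  rintro _ a _ _ ⟨n, p, q, h, rfl, rfl⟩ ⟨_, _, q', h', ⟨⟩, rfl⟩
  exact congrArg (fun r => (⟨n + 1, r⟩ : (stages R B).State)) (deterministic_fold _
    ((toStephenStepHom R _).map_edge h) ((toStephenStepHom R _).map_edge h'))

theorem reads_closure_of_mem {u v : InvWord X} (hr : (u, v) ∈ R ∨ (v, u) ∈ R)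
    {x y : (closure R B).State} (h : (closure R B).Reads v.toList x y) :
    (closure R B).Reads u.toList x y := by
  revert x y
  rw [closure_eq_orbits]
  intro x y h
  obtain ⟨⟨n, p⟩, _, rfl, rfl, hv⟩ := (nextStage R B).exists_reads_of_reads_orbits h
  obtain ⟨q, rfl, hpq⟩ := exists_reads_of_reads_stages (p := p) hv
  have hnext : (stages R B).Reads u.toList (nextStage R B (toStages R B n p))
      (nextStage R B (toStages R B n q)) :=
    (toStages R B (n + 1)).reads (reads_added_toStephenStep ⟨u, v, p, q, hr, hpq⟩)
  replace hnext := (toOrbits _ (nextStage R B)).reads hnext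
  rwa [toOrbits_apply, toOrbits_apply] at hnext

theorem isClosedInverse_closure (hB : B.Involutive) :
    (closure R B).IsClosedInverse R where
  deterministic := deterministic_closure
  involutive := involutive_closure hB
  reads_iff _ hr _ _ := ⟨reads_closure_of_mem (.inr hr), reads_closure_of_mem (.inl hr)⟩

/-- The canonical morphism from an automaton to its closure. -/
def toClosure (R : Set (InvWord X × InvWord X)) (B : Automaton (X × Bool)) :
    Hom B (closure R B) where
  toFun q := Quot.mk _ ⟨0, q⟩
  map_edge h := ⟨0, _, _, h, rfl, rfl⟩
  map_init hq := ⟨0, _, hq, rfl⟩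
  map_final hq := ⟨0, _, hq, rfl⟩

theorem init_closure_subset : (closure R B).init ⊆ toClosure R B '' B.init := by
  rintro _ ⟨n, q, hq, rfl⟩
  induction n with
  | zero => exact ⟨q, hq, rfl⟩
  | succ n ih =>
    obtain ⟨_, ⟨_, ⟨q, hq, rfl⟩, rfl⟩, rfl⟩ := hq
    exact Quot.sound (r := NextRel R B) (a := ⟨n, q⟩) rfl ▸ ih q hq

theorem subsingleton_init_closure (hB : B.init.Subsingleton) :
    (closure R B).init.Subsingleton :=
  (hB.image _).anti init_closure_subset

theorem nonempty_hom_closure (hC : C.IsClosedInverse R) (f : Hom B C) :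
    Nonempty (Hom (closure R B) C) := by
  choose extend extend_apply using fun n => exists_hom_stephenStep (B := stephenSeq R B n) hC
  let onSeq (n : ℕ) : Hom (stephenSeq R B n) C := Nat.rec f extend n
  let onStages : Hom (stages R B) C :=
    { toFun := fun x => onSeq x.1 x.2
      map_edge := by
        rintro _ a _ ⟨n, p, q, h, rfl, rfl⟩
        exact (onSeq n).map_edge h
      map_init := (onSeq _).map_init
      map_final := (onSeq _).map_final }
  rw [closure_eq_orbits]
  refine ⟨onStages.identifyLift ?_⟩
  rintro ⟨n, p⟩ _ rfl
  exact (extend_apply n (onSeq n) p).symm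

end Closure

/-! ### Schützenberger automata -/

section Schutzenberger

variable {X : Type u} {R : Set (InvWord X × InvWord X)} {w : InvWord X}

theorem greenR_mul_of_greenR_mul_mul {M : Type u} [Monoid M] {m n a b : M} (hm : GreenR m n)
    (hmab : GreenR (m * a * b) n) : GreenR (m * a) n := by
  obtain ⟨⟨x, rfl⟩, -⟩ := hm
  obtain ⟨-, y, hy⟩ := hmab
  exact ⟨⟨x * a, mul_assoc _ _ _⟩, b * y, hy.trans (mul_assoc _ _ _)⟩

theorem reads_schutzenberger {v : InvWord X} {p q : (schutzenberger R w).State} :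
    (schutzenberger R w).Reads v.toList p q ↔ q.1 = p.1 * (v : InvPres R) := by
  induction v using FreeMonoid.recOn generalizing p with
  | one =>
    rw [reads_one, Con.coe_one, mul_one]
    exact eq_comm.trans Subtype.ext_iff
  | of_mul x v ih =>
    simp only [reads_mul, reads_of, ih, Con.coe_mul, ← mul_assoc]
    constructor
    · rintro ⟨r, hr, hq⟩
      rw [hq, hr]
    · intro hq
      exact ⟨⟨_, greenR_mul_of_greenR_mul_mul p.2 (hq ▸ q.2)⟩, rfl, hq⟩

theorem isClosedInverse_schutzenberger : (schutzenberger R w).IsClosedInverse R where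
  deterministic _ _ _ _ h h' := Subtype.ext (h.trans h'.symm)
  involutive p x q h := by
    have hpq : q.1 * q.1⁻¹ = p.1 * p.1⁻¹ :=
      (InverseMonoid.mul_inv_eq_of_greenR q.2).trans
        (InverseMonoid.mul_inv_eq_of_greenR p.2).symm
    change q.1 = _ at h
    rw [h] at hpq
    exact (h ▸ InverseMonoid.mul_mul_inv_cancel hpq).symm
  reads_iff r hr p q := by
    rw [reads_schutzenberger, reads_schutzenberger, InvPres.coe_eq_of_mem hr]

theorem accessible_schutzenberger : (schutzenberger R w).Accessible := by
  intro q
  obtain ⟨v, hv⟩ := InvPres.exists_word_eq q.1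
  refine ⟨_, rfl, v.toList, reads_schutzenberger.2 ?_⟩
  change q.1 = (w : InvPres R) * (w : InvPres R)⁻¹ * v
  rw [← InverseMonoid.mul_inv_eq_of_greenR q.2, hv, InverseMonoid.mul_inv_mul]

theorem subsingleton_init_schutzenberger : (schutzenberger R w).init.Subsingleton :=
  Set.subsingleton_singleton

theorem accepts_schutzenberger {v : InvWord X} :
    (schutzenberger R w).Accepts v.toList ↔ (w : InvPres R) ≤ v := by
  rw [InverseMonoid.le_def, eq_comm]
  constructor
  · rintro ⟨_, rfl, _, rfl, h⟩
    exact reads_schutzenberger.1 h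
  · intro h
    exact ⟨_, rfl, _, rfl, reads_schutzenberger.2 h⟩

theorem nonempty_hom_schutzenberger {C : Automaton (X × Bool)} (hC : C.IsClosedInverse R)
    (hw : C.Accepts w.toList) : Nonempty (Hom (schutzenberger R w) C) := by
  obtain ⟨p₀, hp₀, q₀, hq₀, hpq⟩ := hw
  have hstate (m : (schutzenberger R w).State) :
      ∃ s, ∀ v : InvWord X, (v : InvPres R) = m.1 → C.Reads v.toList p₀ s := by
    obtain ⟨m, -, y, hy⟩ := m
    obtain ⟨u, rfl⟩ := InvPres.exists_word_eq m
    obtain ⟨y, rfl⟩ := InvPres.exists_word_eq y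
    obtain ⟨s, hs, -⟩ := reads_mul.1 ((hC.reads_congr (w := u * y) hy).1 hpq)
    exact ⟨s, fun v hv => (hC.reads_congr hv).2 hs⟩
  choose f hf using hstate
  refine ⟨⟨f, fun {m x n} h => ?_, ?_, ?_⟩⟩
  · obtain ⟨v, hv⟩ := InvPres.exists_word_eq m.1
    have hn : ((v * FreeMonoid.of x : InvWord X) : InvPres R) = n.1 := by
      rw [Con.coe_mul, hv]
      exact h.symm
    obtain ⟨s, hs, hx⟩ := reads_mul.1 (hf n _ hn)
    rw [hC.deterministic.reads (hf m v hv) hs]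
    exact reads_of.1 hx
  · intro m hm
    have h := hf m (w * wordInv w) (congrArg Subtype.val hm).symm
    rwa [← ((reads_mul_wordInv hC.deterministic hC.involutive).1 h).1]
  · intro m hm
    rwa [← hC.deterministic.reads hpq (hf m w (congrArg Subtype.val hm).symm)]

end Schutzenberger

/-! ### Automata of upper sets -/

section UpperSets

variable {X : Type u} {R : Set (InvWord X × InvWord X)} {K : Set (InvPres R)}

/-- The automaton whose states are the upper sets of the presented monoid `Inv⟨X | R⟩`, on which
letters act by right translation. A word can only be accepted if its class lies in `K`. -/
def upperSetAutomaton (K : Set (InvPres R)) : Automaton (X × Bool) where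
  State := UpperSet (InvPres R)
  init := {L | 1 ∈ L}
  final := {L | ∀ m ∈ L, m ∈ K}
  edge L x L' := InverseMonoid.Transports ((FreeMonoid.of x : InvWord X) : InvPres R) L L'

theorem reads_upperSetAutomaton {w : InvWord X} {L L' : (upperSetAutomaton K).State} :
    (upperSetAutomaton K).Reads w.toList L L' ↔
      InverseMonoid.Transports (w : InvPres R) L L' := by
  induction w using FreeMonoid.recOn generalizing L with
  | one => exact reads_one.trans InverseMonoid.transports_one.symm
  | of_mul x w ih =>
    exact reads_mul.trans <| (exists_congr fun _ => and_congr reads_of ih).trans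
      InverseMonoid.transports_mul.symm

theorem isClosedInverse_upperSetAutomaton : (upperSetAutomaton K).IsClosedInverse R where
  deterministic _ _ _ _ h h' := h.unique h'
  involutive _ _ _ h := h.inv
  reads_iff _ hr _ _ := by
    rw [reads_upperSetAutomaton, reads_upperSetAutomaton, InvPres.coe_eq_of_mem hr]

theorem coe_mem_of_accepts_upperSetAutomaton {w : InvWord X}
    (h : (upperSetAutomaton K).Accepts w.toList) : (w : InvPres R) ∈ K := by
  obtain ⟨L, hL, L', hL', h⟩ := h
  exact hL' _ (one_mul (w : InvPres R) ▸ (reads_upperSetAutomaton.1 h).1 1 hL)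

end UpperSets

/-! ### Erasing a letter -/

section AddLoops

variable {A : Type u} [DecidableEq A] {i : A} {B : Automaton ({a : A // a ≠ i} × Bool)}

theorem eraseWord_of_eq {x : A × Bool} (hx : x.1 = i) : eraseWord i (FreeMonoid.of x) = 1 := by
  simp [eraseWord, hx]

theorem eraseWord_of_ne {x : A × Bool} (hx : x.1 ≠ i) :
    eraseWord i (FreeMonoid.of x) = FreeMonoid.of (⟨x.1, hx⟩, x.2) := by
  simp [eraseWord, hx]

theorem edge_addLoops_iff {x : A × Bool} {p q : B.State} :
    (B.addLoops i).edge p x q ↔ B.Reads (eraseWord i (FreeMonoid.of x)).toList p q := by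
  change _ ∨ _ ↔ _
  by_cases hx : x.1 = i
  · rw [eraseWord_of_eq hx, reads_one]
    simp [hx]
  · rw [eraseWord_of_ne hx, reads_of]
    simp [hx]

theorem reads_addLoops_iff {w : InvWord A} {p q : B.State} :
    (B.addLoops i).Reads w.toList p q ↔ B.Reads (eraseWord i w).toList p q := by
  induction w using FreeMonoid.recOn generalizing p with
  | one => rfl
  | of_mul x w ih =>
    rw [map_mul (eraseWord i), reads_mul (B := B)]
    exact reads_mul.trans (exists_congr fun r => and_congr (reads_of.trans edge_addLoops_iff) ih)

theorem accepts_addLoops_iff {w : InvWord A} :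
    (B.addLoops i).Accepts w.toList ↔ B.Accepts (eraseWord i w).toList :=
  exists_congr fun _ => and_congr_right fun _ => exists_congr fun _ =>
    and_congr_right fun _ => reads_addLoops_iff

end AddLoops

section Contracted

variable {A : Type u} {i : A} {B : Automaton (A × Bool)}
  {C : Automaton ({a : A // a ≠ i} × Bool)}

theorem Involutive.addLoops (hC : C.Involutive) : (C.addLoops i).Involutive := by
  rintro p x q (⟨hx, h⟩ | ⟨hx, h⟩)
  · exact .inl ⟨hx, h.symm⟩
  · exact .inr ⟨hx, hC h⟩

theorem Involutive.contracted (hB : B.Involutive) : (B.contracted i).Involutive :=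
  have hErase : (B.eraseEdges i).Involutive := fun _ _ _ h => hB h
  (hErase.identify _).identify _

theorem subsingleton_init_contracted (hB : B.init.Subsingleton) :
    (B.contracted i).init.Subsingleton :=
  Set.Subsingleton.image (hB.image _) _

/-- Contraction is left adjoint to the addition of loops: a morphism into an automaton with loops
labelled `i` factors through the `i`-contracted automaton. -/
def Hom.contractedLift (f : Hom B (C.addLoops i)) (hC : C.Deterministic) :
    Hom (B.contracted i) C :=
  let onErased : Hom (B.eraseEdges i) C :=
    { toFun := f
      map_edge := fun {_ x _} h =>
        ((f.map_edge h).resolve_left fun h' => x.1.2 h'.1).choose_spec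
      map_init := f.map_init
      map_final := f.map_final }
  let onIdentified : Hom ((B.eraseEdges i).identify fun p q => B.edge p (i, true) q) C :=
    onErased.identifyLift fun _ _ h =>
      ((f.map_edge h).resolve_right fun ⟨h', _⟩ => h' rfl).2
  onIdentified.identifyLift fun _ _ h => h.apply_eq hC onIdentified

/-- The canonical morphism from an involutive automaton to its `i`-contracted automaton with
loops labelled `i` and `i⁻¹`. -/
def toContracted (i : A) (hB : B.Involutive) : Hom B ((B.contracted i).addLoops i) where
  toFun q := Quot.mk _ (Quot.mk _ q)
  map_edge {p x q} h := by
    by_cases hx : x.1 = i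
    · refine .inl ⟨hx, congrArg (Quot.mk _) ?_⟩
      obtain ⟨_, _ | _⟩ := x <;> subst hx
      · exact (Quot.sound (hB h)).symm
      · exact Quot.sound h
    · exact .inr ⟨hx, _, _, ⟨p, q, h, rfl, rfl⟩, rfl, rfl⟩
  map_init hq := ⟨_, ⟨_, hq, rfl⟩, rfl⟩
  map_final hq := ⟨_, ⟨_, hq, rfl⟩, rfl⟩

theorem Accessible.contracted (ha : B.Accessible) (hB : B.Involutive) :
    (B.contracted i).Accessible := by
  classical
  rintro ⟨⟨q⟩⟩
  obtain ⟨p, hp, w, hw⟩ := ha q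
  exact ⟨_, (toContracted i hB).map_init hp, _,
    reads_addLoops_iff (w := FreeMonoid.ofList w).1 ((toContracted i hB).reads hw)⟩

end Contracted

section ClosureContracted

variable {A : Type u} [DecidableEq A] {i : A} {B : Automaton (A × Bool)}
  {R : Set (InvWord {a : A // a ≠ i} × InvWord {a : A // a ≠ i})}
  {w : InvWord {a : A // a ≠ i}}

/-- The upper set generated by the words read, after erasing `i`, from an initial state to `q`. -/
def erasedLanguage (i : A) (R : Set (InvWord {a : A // a ≠ i} × InvWord {a : A // a ≠ i}))
    (B : Automaton (A × Bool)) (q : B.State) : UpperSet (InvPres R) :=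
  upperClosure ((fun v : InvWord A => (eraseWord i v : InvPres R)) ''
    {v | ∃ p ∈ B.init, B.Reads v.toList p q})

theorem mem_erasedLanguage {q : B.State} {m : InvPres R} : m ∈ erasedLanguage i R B q ↔
    ∃ v : InvWord A, (∃ p ∈ B.init, B.Reads v.toList p q) ∧ (eraseWord i v : InvPres R) ≤ m :=
  mem_upperClosure.trans Set.exists_mem_image

theorem mul_mem_erasedLanguage {p q : B.State} {x : A × Bool} (h : B.edge p x q) {m : InvPres R}
    (hm : m ∈ erasedLanguage i R B p) :
    m * (eraseWord i (FreeMonoid.of x) : InvPres R) ∈ erasedLanguage i R B q := by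
  obtain ⟨v, ⟨p₀, hp₀, hv⟩, hvm⟩ := mem_erasedLanguage.1 hm
  refine mem_erasedLanguage.2 ⟨v * FreeMonoid.of x,
    ⟨p₀, hp₀, reads_mul.2 ⟨p, hv, reads_of.2 h⟩⟩, ?_⟩
  rw [map_mul, Con.coe_mul]
  exact mul_le_mul_left hvm _

theorem transports_erasedLanguage (hB : B.Involutive) {p q : B.State} {x : A × Bool}
    (h : B.edge p x q) : InverseMonoid.Transports (eraseWord i (FreeMonoid.of x) : InvPres R)
      (erasedLanguage i R B p) (erasedLanguage i R B q) := by
  refine ⟨fun m => mul_mem_erasedLanguage h, fun m hm => ?_⟩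
  rw [InvPres.coe_inv, ← eraseWord_wordInv, wordInv_of]
  exact mul_mem_erasedLanguage (hB h) hm

theorem exists_accepts_of_accepts_closure_contracted (hB : B.Involutive)
    (h : (closure R (B.contracted i)).Accepts w.toList) :
    ∃ v : InvWord A, B.Accepts v.toList ∧ (eraseWord i v : InvPres R) ≤ w := by
  let K : Set (InvPres R) :=
    {m | ∃ v : InvWord A, B.Accepts v.toList ∧ (eraseWord i v : InvPres R) ≤ m}
  let f : Hom B ((upperSetAutomaton K).addLoops i) :=
    { toFun := erasedLanguage i R B
      map_edge := fun h => edge_addLoops_iff.2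
        (reads_upperSetAutomaton.2 (transports_erasedLanguage hB h))
      map_init := fun {p} hp => mem_erasedLanguage.2 ⟨1, ⟨p, hp, rfl⟩, le_rfl⟩
      map_final := fun {q} hq m hm => by
        obtain ⟨v, ⟨p, hp, hv⟩, hvm⟩ := mem_erasedLanguage.1 hm
        exact ⟨v, ⟨p, hp, q, hq, hv⟩, hvm⟩ }
  have hK := isClosedInverse_upperSetAutomaton (K := K)
  obtain ⟨g⟩ := nonempty_hom_closure hK (f.contractedLift hK.deterministic)
  exact coe_mem_of_accepts_upperSetAutomaton (g.accepts h)

theorem isomorphic_closure_contracted_iff (hB : B.Involutive) (ha : B.Accessible)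
    (hi : B.init.Subsingleton) (f : Hom B ((schutzenberger R w).addLoops i)) :
    Isomorphic (closure R (B.contracted i)) (schutzenberger R w) ↔
      ∃ v : InvWord A, B.Accepts v.toList ∧ (eraseWord i v : InvPres R) = w := by
  have hcl := isClosedInverse_closure (R := R) (hB.contracted (i := i))
  have hw := isClosedInverse_schutzenberger (R := R) (w := w)
  constructor
  · intro h
    obtain ⟨g⟩ := h.nonempty_hom_symm
    obtain ⟨v, hv, hvw⟩ := exists_accepts_of_accepts_closure_contracted hB
      (g.accepts (accepts_schutzenberger.2 le_rfl))
    exact ⟨v, hv, hvw.antisymm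
      (accepts_schutzenberger.1 (accepts_addLoops_iff.1 (f.accepts hv)))⟩
  · rintro ⟨v, hv, hvw⟩
    have haccepts : (closure R (B.contracted i)).Accepts w.toList := by
      obtain ⟨p, hp, q, hq, h⟩ := (toClosure R _).accepts
        (accepts_addLoops_iff.1 ((toContracted i hB).accepts hv))
      exact ⟨p, hp, q, hq, (hcl.reads_congr hvw).1 h⟩
    obtain ⟨g⟩ := nonempty_hom_closure hw (f.contractedLift hw.deterministic)
    obtain ⟨g'⟩ := nonempty_hom_schutzenberger hcl haccepts
    exact isomorphic_of_hom_hom hcl.deterministic (accessible_closure (ha.contracted hB))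
      (subsingleton_init_closure (subsingleton_init_contracted hi)) hw.deterministic
      accessible_schutzenberger subsingleton_init_schutzenberger g g'

end ClosureContracted

/-! ### Product automata -/

section Product

variable {S : Type u}

theorem reads_prod_iff {ι : Type u} {B : ι → Automaton S} {w : List S} {p q : (prod B).State} :
    (prod B).Reads w p q ↔ ∀ i, (B i).Reads w (p i) (q i) := by
  induction w generalizing p with
  | nil => exact funext_iff
  | cons a w ih =>
    constructor
    · rintro ⟨r, h, h'⟩ i
      exact ⟨r i, h i, ih.1 h' i⟩
    · intro h
      choose r h h' using h
      exact ⟨r, h, ih.2 h'⟩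

theorem accepts_prod_iff {ι : Type u} {B : ι → Automaton S} {w : List S} :
    (prod B).Accepts w ↔ ∀ i, (B i).Accepts w := by
  constructor
  · rintro ⟨p, hp, q, hq, h⟩ i
    exact ⟨p i, hp i, q i, hq i, reads_prod_iff.1 h i⟩
  · intro h
    choose p hp q hq h using h
    exact ⟨p, hp, q, hq, reads_prod_iff.2 h⟩

theorem subsingleton_init_prod {ι : Type u} {B : ι → Automaton S}
    (hB : ∀ i, (B i).init.Subsingleton) : (prod B).init.Subsingleton :=
  fun _ hp _ hq => funext fun i => hB i (hp i) (hq i)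

/-- The inclusion of the trim part. -/
def ofTrim (B : Automaton S) : Hom B.trim B where
  toFun := Subtype.val
  map_edge := id
  map_init := id
  map_final := id

/-- The projection of a product onto one of its factors. -/
def prodProj {ι : Type u} (B : ι → Automaton S) (i : ι) : Hom (prod B) (B i) where
  toFun p := p i
  map_edge h := h i
  map_init h := h i
  map_final h := h i

variable {B : Automaton S}

theorem reads_trim_of_reads {w : List S} {p q : B.trim.State} (h : B.Reads w p.1 q.1) :
    B.trim.Reads w p q := by
  induction w generalizing p with
  | nil => exact Subtype.ext h
  | cons a w ih =>
    obtain ⟨r, h₁, h₂⟩ := h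
    obtain ⟨p₀, hp₀, _, _, v, _, hv, _⟩ := p.2
    obtain ⟨_, _, t, ht, _, v', _, hv'⟩ := q.2
    exact ⟨⟨r, p₀, hp₀, t, ht, v ++ [a], w ++ v', reads_append.2 ⟨_, hv, reads_singleton.2 h₁⟩,
      reads_append.2 ⟨_, h₂, hv'⟩⟩, h₁, ih h₂⟩

theorem accessible_trim : B.trim.Accessible := by
  intro p
  obtain ⟨p₀, hp₀, t, ht, v, w, hv, hw⟩ := p.2
  exact ⟨⟨p₀, p₀, hp₀, t, ht, [], v ++ w, rfl, reads_append.2 ⟨_, hv, hw⟩⟩, hp₀, v,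
    reads_trim_of_reads hv⟩

theorem accepts_trim_iff {w : List S} : B.trim.Accepts w ↔ B.Accepts w := by
  refine ⟨(ofTrim B).accepts, ?_⟩
  rintro ⟨p, hp, q, hq, h⟩
  exact ⟨⟨p, p, hp, q, hq, [], w, rfl, h⟩, hp, ⟨q, p, hp, q, hq, w, [], h, rfl⟩, hq,
    reads_trim_of_reads h⟩

end Product

section ProductAutomaton

variable {A : Type u} [DecidableEq A] {R : Set (InvWord A × InvWord A)}
  {w : ∀ i : A, InvWord {a : A // a ≠ i}}

theorem involutive_productAutomaton : (productAutomaton R w).Involutive :=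
  fun _ _ _ h i => isClosedInverse_schutzenberger.involutive.addLoops (h i)

theorem subsingleton_init_productAutomaton : (productAutomaton R w).init.Subsingleton :=
  (subsingleton_init_prod (B := fun i => (schutzenberger (eraseRel i R) (w i)).addLoops i)
    fun _ => subsingleton_init_schutzenberger).preimage Subtype.val_injective

/-- The projection of the product automaton onto its `i`-th component. -/
def productAutomatonProj (R : Set (InvWord A × InvWord A))
    (w : ∀ i : A, InvWord {a : A // a ≠ i}) (i : A) :
    Hom (productAutomaton R w) ((schutzenberger (eraseRel i R) (w i)).addLoops i) :=
  (prodProj _ i).comp (ofTrim _)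

theorem accepts_productAutomaton_iff {v : InvWord A} :
    (productAutomaton R w).Accepts v.toList ↔
      ∀ i, (w i : InvPres (eraseRel i R)) ≤ eraseWord i v :=
  accepts_trim_iff.trans <| accepts_prod_iff.trans <| forall_congr' fun _ =>
    accepts_addLoops_iff.trans accepts_schutzenberger

theorem isomorphic_closure_contracted_productAutomaton_iff (i : A) :
    Isomorphic (closure (eraseRel i R) ((productAutomaton R w).contracted i))
        (schutzenberger (eraseRel i R) (w i)) ↔
      ∃ v : InvWord A, (∀ j, (w j : InvPres (eraseRel j R)) ≤ eraseWord j v) ∧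
        (eraseWord i v : InvPres (eraseRel i R)) = w i := by
  rw [isomorphic_closure_contracted_iff involutive_productAutomaton accessible_trim
    subsingleton_init_productAutomaton (productAutomatonProj R w i)]
  simp only [accepts_productAutomaton_iff]

end ProductAutomaton

end Automaton

/-! ### The image of the eraser morphism -/

theorem mem_mrange_eraserMorphism {A : Type u} [DecidableEq A]
    {R : Set (InvWord A × InvWord A)} {x : ∀ i : A, InvPres (eraseRel i R)} :
    x ∈ MonoidHom.mrange (eraserMorphism R) ↔
      ∃ v : InvWord A, (fun i => (eraseWord i v : InvPres (eraseRel i R))) = x := by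
  constructor
  · rintro ⟨m, rfl⟩
    obtain ⟨v, rfl⟩ := InvPres.exists_word_eq m
    exact ⟨v, rfl⟩
  · rintro ⟨v, rfl⟩
    exact ⟨(v : InvPres R), rfl⟩

theorem inv_mem_mrange_eraserMorphism {A : Type u} [DecidableEq A]
    {R : Set (InvWord A × InvWord A)} {x : ∀ i : A, InvPres (eraseRel i R)}
    (hx : x ∈ MonoidHom.mrange (eraserMorphism R)) :
    x⁻¹ ∈ MonoidHom.mrange (eraserMorphism R) := by
  obtain ⟨v, rfl⟩ := mem_mrange_eraserMorphism.1 hx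
  refine mem_mrange_eraserMorphism.2 ⟨wordInv v, ?_⟩
  funext i
  rw [eraseWord_wordInv]
  rfl

theorem proposition4p13 {A : Type u} [Finite A] [DecidableEq A]
    (R : Set (InvWord A × InvWord A)) (w : ∀ i : A, InvWord {a : A // a ≠ i}) :
    (fun i : A => ((w i : InvWord {a : A // a ≠ i}) : InvPres (eraseRel i R))) ∈
        MonoidHom.mrange (eraserMorphism R) ↔
      ∀ i : A, Automaton.Isomorphic
        (Automaton.closure (eraseRel i R) (Automaton.contracted i (productAutomaton R w)))
        (schutzenberger (eraseRel i R) (w i)) := by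
  set T := MonoidHom.mrange (eraserMorphism R)
  calc _ ↔ ∀ i, ∃ a ∈ T, (fun j => (w j : InvPres (eraseRel j R))) ≤ a ∧ a i = w i :=
        InverseMonoid.mem_iff_forall_exists_le ⟨1, one_mem T⟩
          fun _ ha _ hb => mul_mem (mul_mem ha (inv_mem_mrange_eraserMorphism ha)) hb
    _ ↔ ∀ i, ∃ v : InvWord A, (∀ j, (w j : InvPres (eraseRel j R)) ≤ eraseWord j v) ∧
          (eraseWord i v : InvPres (eraseRel i R)) = w i := by
        simp only [T, mem_mrange_eraserMorphism, exists_exists_eq_and, Pi.le_def]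
    _ ↔ _ := forall_congr' fun i =>
        (Automaton.isomorphic_closure_contracted_productAutomaton_iff i).symm
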